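/- Let $k$ be a field and $K$ an extension field of $k$. Algebraic sets are described by their $K$-points; the Zariski topology and regular functions are given by polynomials with coefficients in $k$ (for $K$ algebraically closed this is the usual language of varieties over $k$). Let $0\le d\le n$, let $\mathrm{Gr}(d,n)$ be the Grassmannian of $d$-dimensional subspaces of $K^n$, and for a $d\times n$ matrix $X$ of rank $d$ let $[X]\in\mathrm{Gr}(d,n)$ be its row space; $\mathrm{Gr}(d,n)$ carries the structure of the quotient of the full rank $d\times n$ matrices by $GL_d$. For a $d$-element subset $I=\{i_1<\dots<i_d\}$ of $[n]=\{1,\dots,n\}$ let $[e_I]$ be the span of the standard basis vectors indexed by $I$, and let $X_{[d]\times I}$ be the $d\times d$ submatrix of $X$ with the columns indexed by $I$. Let $B,B^-\subset GL_n$ be the groups of invertible upper, respectively lower, triangular matrices, acting on $K^n$ (column vectors) in the standard way. For $d$-element subsets $I=\{i_1<\dots<i_d\}$ and $J=\{j_1<\dots<j_d\}$ of $[n]$ the open Richardson variety is $$R_{I,J}=B^-\cdot[e_I]\,\cap\, B\cdot[e_J]\subset\mathrm{Gr}(d,n).$$ Theorem. If $[X]\in R_{I,J}$, then $X_{[d]\times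 I}$ and $X_{[d]\times J}$ are invertible and the matrix $X_{[d]\times I}^{-1}X_{[d]\times J}\in GL_d$ depends only on $[X]$, so that there is a well-defined base change map $$b_{I,J}\colon R_{I,J}\to GL_d,\qquad [X]\mapsto X_{[d]\times I}^{-1}X_{[d]\times J}.$$ Let $G_{I,J}\subset GL_d$ be its image. Then $R_{I,J}\subset \mathrm{Gr}(d,n)$ and $G_{I,J}\subset GL_d$ are locally closed, and $b_{I,J}\colon R_{I,J}\to G_{I,J}$ is a vector bundle of rank $$r=\#\{(m,l)\in[d]\times[n] : l\notin I\cup J,\ i_m<l<j_m\}.$$ That is, $b_{I,J}$ is a regular map, and $G_{I,J}$ is covered by Zariski open subsets $U$ with isomorphisms $b_{I,J}^{-1}(U)\cong U\times\mathbb A^r$ over $U$ (mutually inverse regular maps) such that the transition maps between any two of them are linear on the fibres $\mathbb A^r$. -/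

import Mathlib

/-! ### Regular functions

Everything is done over a field `k`, with points in an extension field `K` of `k`. For `K`
algebraically closed this is the classical language of varieties over `k` (and of varieties over
`K` if `k = K`). `A` stands for a set with coordinates `c : A → σ → K` in an affine space; open and
closed sets and regular functions are given by polynomials with coefficients in `k`. -/

/-- The principal open subset `{Q ≠ 0}`. -/
def principalOpen {k K A σ : Type*} [Field k] [Field K] [Algebra k K]
    (c : A → σ → K) (Q : MvPolynomial σ k) : Set A :=
  {a | MvPolynomial.aeval (c a) Q ≠ 0}

/-- `U` is a Zariski open subset of `S`. -/
def IsOpenIn (k : Type*) {K A σ : Type*} [Field k] [Field K] [Algebra k K]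
    (c : A → σ → K) (U S : Set A) : Prop :=
  U ⊆ S ∧ ∀ a ∈ U, ∃ Q : MvPolynomial σ k, a ∈ principalOpen c Q ∧ S ∩ principalOpen c Q ⊆ U

/-- `S` is locally closed in the Zariski topology: the intersection of a closed set (common zeros
of `Z`) and an open set (union of the principal open subsets of the members of `N`). -/
def IsZariskiLocallyClosed (k : Type*) {K A σ : Type*} [Field k] [Field K] [Algebra k K]
    (c : A → σ → K) (S : Set A) : Prop :=
  ∃ Z N : Set (MvPolynomial σ k),
    S = {a | (∀ P ∈ Z, MvPolynomial.aeval (c a) P = 0) ∧ ∃ Q ∈ N, a ∈ principalOpen c Q}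

/-- `f` is a regular function on `S`: locally on `S` it is a quotient of polynomials. -/
def IsRegularOn (k : Type*) {K A σ : Type*} [Field k] [Field K] [Algebra k K]
    (c : A → σ → K) (S : Set A) (f : A → K) : Prop :=
  ∀ a ∈ S, ∃ P Q : MvPolynomial σ k, a ∈ principalOpen c Q ∧
    ∀ b ∈ S ∩ principalOpen c Q,
      f b = MvPolynomial.aeval (c b) P / MvPolynomial.aeval (c b) Q

/-! ### The Grassmannian -/

/-- The Grassmannian of `d`-dimensional subspaces of `K ^ n`. -/
abbrev Gr (K : Type*) [Field K] (d n : ℕ) : Type _ :=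
  {W : Submodule K (Fin n → K) // Module.finrank K W = d}

/-- The `d × n` matrices of full rank `d`. -/
abbrev FullRank (K : Type*) [Field K] (d n : ℕ) : Type _ :=
  {X : Matrix (Fin d) (Fin n) K // LinearIndependent K X.row}

/-- The entries of a matrix as coordinates. -/
def matrixCoord {K : Type*} {m n : ℕ} (X : Matrix (Fin m) (Fin n) K) : Fin m × Fin n → K :=
  fun p => X p.1 p.2

/-- The entries of a full rank matrix as coordinates. -/
def fullRankCoord {K : Type*} [Field K] {d n : ℕ} (X : FullRank K d n) : Fin d × Fin n → K :=
  matrixCoord X.1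

/-- The row space `[X]`. -/
def rowSpace {K : Type*} [Field K] {d n : ℕ} (X : FullRank K d n) : Gr K d n :=
  ⟨Submodule.span K (Set.range X.1.row), by
    rw [finrank_span_eq_card X.2, Fintype.card_fin]⟩

theorem rowSpace_surjective {K : Type*} [Field K] {d n : ℕ} :
    Function.Surjective (rowSpace : FullRank K d n → Gr K d n) := by
  rintro ⟨W, hW⟩
  let b := Module.finBasisOfFinrankEq K W hW
  have hli : LinearIndependent K (fun i => ((b i : W) : Fin n → K)) :=
    b.linearIndependent.map' W.subtype (Submodule.ker_subtype W)
  refine ⟨⟨Matrix.of fun i => ((b i : W) : Fin n → K), hli⟩, Subtype.ext ?_⟩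
  change Submodule.span K (Set.range fun i => ((b i : W) : Fin n → K)) = W
  have h : (Set.range fun i => ((b i : W) : Fin n → K)) = W.subtype '' Set.range b := by
    rw [← Set.range_comp]; rfl
  rw [h, Submodule.span_image, b.span_eq, Submodule.map_subtype_top]

/-- A subset of the Grassmannian is locally closed. The topology and the regular functions on the
Grassmannian are those of the quotient of the full rank matrices by `GL_d`. -/
def IsLocallyClosedGr (k : Type*) {K : Type*} [Field k] [Field K] [Algebra k K] {d n : ℕ}
    (S : Set (Gr K d n)) : Prop :=
  IsZariskiLocallyClosed k fullRankCoord (rowSpace ⁻¹' S)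

/-- `f` is a regular function on the subset `S` of the Grassmannian: `X ↦ f [X]` is regular on the
set of all matrices `X` with `[X] ∈ S`. -/
def IsRegularOnGr (k : Type*) {K : Type*} [Field k] [Field K] [Algebra k K] {d n : ℕ}
    (S : Set (Gr K d n)) (f : Gr K d n → K) : Prop :=
  IsRegularOn k fullRankCoord (rowSpace ⁻¹' S) (f ∘ rowSpace)

/-- `g` is a regular map from `S` to the Grassmannian: locally on `S` it is the row space of a
full rank matrix whose entries are regular functions. -/
def IsRegularToGr (k : Type*) {K A σ : Type*} [Field k] [Field K] [Algebra k K] {d n : ℕ}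
    (c : A → σ → K) (S : Set A) (g : A → Gr K d n) : Prop :=
  ∀ a ∈ S, ∃ Q : MvPolynomial σ k, a ∈ principalOpen c Q ∧
    ∃ F : A → FullRank K d n,
      (∀ i j, IsRegularOn k c (S ∩ principalOpen c Q) fun b => (F b).1 i j) ∧
      ∀ b ∈ S ∩ principalOpen c Q, rowSpace (F b) = g b

/-! ### Vector bundles -/

/-- The coordinates on the product of a space of matrices with affine `r`-space. -/
def prodCoord {K : Type*} {m n r : ℕ} (x : Matrix (Fin m) (Fin n) K × (Fin r → K)) :
    (Fin m × Fin n) ⊕ Fin r → K :=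
  Sum.elim (matrixCoord x.1) x.2

/-- A local trivialization of a map `π` from a subset `E` of a Grassmannian to a set `B` of
matrices: an open subset `U` of `B` and mutually inverse regular maps `W ↦ (π W, coord W)` and
`point` between `E ∩ π⁻¹ U` and `U × 𝔸^r`, compatible with the projections to `U`. -/
structure LocalTrivialization (k : Type*) {K : Type*} [Field k] [Field K] [Algebra k K]
    {d n m : ℕ} (E : Set (Gr K d n)) (B : Set (Matrix (Fin m) (Fin m) K))
    (π : Gr K d n → Matrix (Fin m) (Fin m) K) (r : ℕ) where
  U : Set (Matrix (Fin m) (Fin m) K)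
  isOpen_U : IsOpenIn k matrixCoord U B
  coord : Gr K d n → Fin r → K
  point : Matrix (Fin m) (Fin m) K × (Fin r → K) → Gr K d n
  regular_coord : ∀ i, IsRegularOnGr k (E ∩ π ⁻¹' U) fun W => coord W i
  regular_point : IsRegularToGr k prodCoord (U ×ˢ Set.univ) point
  point_mem : ∀ A ∈ U, ∀ v, point (A, v) ∈ E
  proj_point : ∀ A ∈ U, ∀ v, π (point (A, v)) = A
  coord_point : ∀ A ∈ U, ∀ v, coord (point (A, v)) = v
  point_coord : ∀ W ∈ E, π W ∈ U → point (π W, coord W) = W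

/-- `π : E → B` is a (Zariski locally trivial) vector bundle of rank `r`: it is a regular map, and
there are local trivializations whose domains cover `B` and whose transition maps are linear on
the fibres. -/
def IsVectorBundle (k : Type*) {K : Type*} [Field k] [Field K] [Algebra k K]
    {d n m : ℕ} (E : Set (Gr K d n)) (B : Set (Matrix (Fin m) (Fin m) K))
    (π : Gr K d n → Matrix (Fin m) (Fin m) K) (r : ℕ) : Prop :=
  Set.MapsTo π E B ∧
  (∀ i j, IsRegularOnGr k E fun W => π W i j) ∧
  ∃ 𝒯 : Set (LocalTrivialization k E B π r),
    (∀ A ∈ B, ∃ t ∈ 𝒯, A ∈ t.U) ∧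
    ∀ t ∈ 𝒯, ∀ t' ∈ 𝒯, ∀ A ∈ t.U ∩ t'.U,
      IsLinearMap K fun v : Fin r → K => t'.coord (t.point (A, v))

/-! ### Open Richardson varieties and base change -/

/-- The coordinate subspace `[e_I]` spanned by the standard basis vectors indexed by `I`. -/
def coordSubspace (K : Type*) [Field K] {n : ℕ} (I : Finset (Fin n)) :
    Submodule K (Fin n → K) :=
  Submodule.span K ((fun i => (Pi.single i 1 : Fin n → K)) '' (I : Set (Fin n)))

/-- The Bruhat cell `Z_I⁺`, the orbit of `[e_I]` under the upper triangular matrices. -/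
def bruhatCellPos (K : Type*) [Field K] (d : ℕ) {n : ℕ} (I : Finset (Fin n)) :
    Set (Gr K d n) :=
  {W | ∃ g : GL (Fin n) K, (∀ i j, j < i → g.1 i j = 0) ∧
    W.1 = (coordSubspace K I).map g.1.mulVecLin}

/-- The opposite Bruhat cell `Z_I⁻`, the orbit of `[e_I]` under the lower triangular matrices. -/
def bruhatCellNeg (K : Type*) [Field K] (d : ℕ) {n : ℕ} (I : Finset (Fin n)) :
    Set (Gr K d n) :=
  {W | ∃ g : GL (Fin n) K, (∀ i j, i < j → g.1 i j = 0) ∧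
    W.1 = (coordSubspace K I).map g.1.mulVecLin}

/-- The open Richardson variety `Z_I⁻ ∩ Z_J⁺`. -/
def openRichardson (K : Type*) [Field K] (d : ℕ) {n : ℕ} (I J : Finset (Fin n)) :
    Set (Gr K d n) :=
  bruhatCellNeg K d I ∩ bruhatCellPos K d J

/-- The `d × d` submatrix of `X` with columns indexed by `I`, in increasing order. -/
def columnMinor {K : Type*} {d n : ℕ} (X : Matrix (Fin d) (Fin n) K)
    (I : Finset (Fin n)) (hI : I.card = d) : Matrix (Fin d) (Fin d) K :=
  X.submatrix id (I.orderEmbOfFin hI)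

/-- The base change map `[X] ↦ X_I⁻¹ X_J`, computed with a chosen representative `X`. -/
noncomputable def baseChange {K : Type*} [Field K] {d n : ℕ} (I J : Finset (Fin n))
    (hI : I.card = d) (hJ : J.card = d) (W : Gr K d n) : Matrix (Fin d) (Fin d) K :=
  let X := (Function.surjInv rowSpace_surjective W).1
  (columnMinor X I hI)⁻¹ * columnMinor X J hJ

/-! Gaussian elimination describes the two cells: $[X]\in B^-[e_I]$ means that $X_I$ is invertible
and row $m$ of $X_I^{-1}X$ vanishes to the left of $i_m$; $[X]\in B[e_J]$ means that $X_J$ is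
invertible and row $m$ of $X_J^{-1}X$ vanishes to the right of $j_m$ (`exists_blockTriangular_iff`).
Put $A=X_I^{-1}X_J$ and $Y=X_J^{-1}X$, so that $AY=X_I^{-1}X$. The columns of $Y$ in $J$ form the
identity and those in $I$ form $A^{-1}$. Hence $[X]$ amounts to $A$ together with the columns $y_l$
of $Y$ for $l\notin I\cup J$.

The vanishing conditions separate by columns. Those in $I\cup J$ constrain only $A$ and cut out the
image; any such $A$ is attained by taking all $y_l=0$ (`image_baseChange`). For $l\notin I\cup J$
they are the linear equations $(y_l)_m=0$ if $j_m<l$ and $(Ay_l)_m=0$ if $l<i_m$. These are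
independent: in a relation $\alpha+\beta A=0$ one has $\beta=-\alpha A^{-1}$, and the entries of
$A^{-1}$ in rows with $j_m<l$ and columns with $l<i_{m'}$ vanish
(`IsBaseChangeMatrix.eq_zero_of_add_vecMul_eq_zero`). As $i_m\le j_m$ for all $m$
(`IsBaseChangeMatrix.le`), exactly the indices with $i_m<l<j_m$ carry no equation, which gives the
rank $r$.

For a local trivialization, complete the equations by coordinate functions $y_l\mapsto
(y_l)_{c(l,m)}$ at the free $m$ (`IsBaseChangeMatrix.exists_columnSystem`). A fixed choice $c$ works
on the open set where the determinants of the resulting square systems do not vanish. Inverting the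
systems is regular in $A$ and linear in the fibre coordinates, so the transition maps are linear. -/

/-! ### Polynomial functions -/

/-- `f` is a polynomial function in the coordinates `c`, with coefficients in `k`. -/
def IsPolyFun (k : Type*) {K A σ : Type*} [Field k] [Field K] [Algebra k K]
    (c : A → σ → K) (f : A → K) : Prop :=
  ∃ P : MvPolynomial σ k, ∀ a, f a = MvPolynomial.aeval (c a) P

namespace IsPolyFun

variable {k K A σ : Type*} [Field k] [Field K] [Algebra k K] {c : A → σ → K}

theorem coord (s : σ) : IsPolyFun k c fun a => c a s :=
  ⟨MvPolynomial.X s, by simp⟩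

theorem zero : IsPolyFun k c fun _ => 0 := ⟨0, by simp⟩

theorem one : IsPolyFun k c fun _ => 1 := ⟨1, by simp⟩

theorem ite {p : Prop} [Decidable p] {f g : A → K} (hf : IsPolyFun k c f)
    (hg : IsPolyFun k c g) : IsPolyFun k c fun a => if p then f a else g a := by
  split_ifs <;> assumption

theorem sub {f g : A → K} (hf : IsPolyFun k c f) (hg : IsPolyFun k c g) :
    IsPolyFun k c fun a => f a - g a := by
  obtain ⟨P, hP⟩ := hf
  obtain ⟨Q, hQ⟩ := hg
  exact ⟨P - Q, by simp [hP, hQ]⟩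

theorem mul {f g : A → K} (hf : IsPolyFun k c f) (hg : IsPolyFun k c g) :
    IsPolyFun k c fun a => f a * g a := by
  obtain ⟨P, hP⟩ := hf
  obtain ⟨Q, hQ⟩ := hg
  exact ⟨P * Q, by simp [hP, hQ]⟩

theorem units_smul (u : ℤˣ) {f : A → K} (hf : IsPolyFun k c f) :
    IsPolyFun k c fun a => u • f a := by
  obtain ⟨P, hP⟩ := hf
  refine ⟨(u : ℤ) • P, fun a => ?_⟩
  simp only [map_zsmul, hP, Units.smul_def]

theorem sum {ι : Type*} (s : Finset ι) {f : ι → A → K} (hf : ∀ i, IsPolyFun k c (f i)) :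
    IsPolyFun k c fun a => ∑ i ∈ s, f i a := by
  choose P hP using hf
  exact ⟨∑ i ∈ s, P i, by simp [hP]⟩

theorem prod {ι : Type*} (s : Finset ι) {f : ι → A → K} (hf : ∀ i, IsPolyFun k c (f i)) :
    IsPolyFun k c fun a => ∏ i ∈ s, f i a := by
  choose P hP using hf
  exact ⟨∏ i ∈ s, P i, by simp [hP]⟩

theorem det {ι : Type*} [Fintype ι] [DecidableEq ι] {M : A → Matrix ι ι K}
    (hM : ∀ i j, IsPolyFun k c fun a => M a i j) : IsPolyFun k c fun a => (M a).det := by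
  simp only [Matrix.det_apply]
  exact sum _ fun σ => units_smul _ (prod _ fun i => hM _ _)

theorem adjugate {ι : Type*} [Fintype ι] [DecidableEq ι] {M : A → Matrix ι ι K}
    (hM : ∀ i j, IsPolyFun k c fun a => M a i j) (i j : ι) :
    IsPolyFun k c fun a => (M a).adjugate i j := by
  simp only [Matrix.adjugate_apply]
  refine det fun i' j' => ?_
  simp only [Matrix.updateRow_apply, Pi.single_apply]
  exact ite (ite one zero) (hM _ _)

theorem mulApply {ι κ μ : Type*} [Fintype κ] {M : A → Matrix ι κ K} {N : A → Matrix κ μ K}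
    (hM : ∀ i j, IsPolyFun k c fun a => M a i j) (hN : ∀ i j, IsPolyFun k c fun a => N a i j)
    (i : ι) (j : μ) : IsPolyFun k c fun a => (M a * N a) i j := by
  simp only [Matrix.mul_apply]
  exact sum _ fun l => (hM _ _).mul (hN _ _)

theorem mulVecApply {ι κ : Type*} [Fintype κ] {M : A → Matrix ι κ K} {v : A → κ → K}
    (hM : ∀ i j, IsPolyFun k c fun a => M a i j) (hv : ∀ i, IsPolyFun k c fun a => v a i)
    (i : ι) : IsPolyFun k c fun a => (M a).mulVec (v a) i := by
  simp only [Matrix.mulVec, dotProduct]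
  exact sum _ fun l => (hM _ _).mul (hv _)

theorem isRegularOn_div {f g h : A → K} {S : Set A} (hf : IsPolyFun k c f)
    (hg : IsPolyFun k c g) (hne : ∀ a ∈ S, g a ≠ 0) (hh : ∀ a ∈ S, h a = f a / g a) :
    IsRegularOn k c S h := by
  obtain ⟨P, hP⟩ := hf
  obtain ⟨Q, hQ⟩ := hg
  intro a ha
  refine ⟨P, Q, ?_, fun b hb => ?_⟩
  · change MvPolynomial.aeval (c a) Q ≠ 0
    rw [← hQ]
    exact hne a ha
  · rw [hh b hb.1, hP, hQ]

theorem isRegularOn {f : A → K} {S : Set A} (hf : IsPolyFun k c f) : IsRegularOn k c S f :=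
  hf.isRegularOn_div one (by simp) (by simp)

/-- The entries of `M⁻¹ N` are regular where `M` is invertible. -/
theorem isRegularOn_inv_mul {ι μ : Type*} [Fintype ι] [DecidableEq ι] {M : A → Matrix ι ι K}
    {N : A → Matrix ι μ K} {S : Set A} (hM : ∀ i j, IsPolyFun k c fun a => M a i j)
    (hN : ∀ i j, IsPolyFun k c fun a => N a i j) (hS : ∀ a ∈ S, (M a).det ≠ 0) (i : ι) (j : μ) :
    IsRegularOn k c S fun a => ((M a)⁻¹ * N a) i j := by
  refine (mulApply (adjugate hM) hN i j).isRegularOn_div (det hM) hS fun a _ => ?_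
  simp [Matrix.inv_def, div_eq_inv_mul]

/-- The entries of `M⁻¹ v` are regular where `M` is invertible. -/
theorem isRegularOn_inv_mulVec {ι : Type*} [Fintype ι] [DecidableEq ι] {M : A → Matrix ι ι K}
    {v : A → ι → K} {S : Set A} (hM : ∀ i j, IsPolyFun k c fun a => M a i j)
    (hv : ∀ i, IsPolyFun k c fun a => v a i) (hS : ∀ a ∈ S, (M a).det ≠ 0) (i : ι) :
    IsRegularOn k c S fun a => (M a)⁻¹.mulVec (v a) i := by
  refine (mulVecApply (adjugate hM) hv i).isRegularOn_div (det hM) hS fun a _ => ?_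
  simp [Matrix.inv_def, div_eq_inv_mul, Matrix.smul_mulVec]

theorem isZariskiLocallyClosed {ι : Type*} {f : ι → A → K} {g : A → K} {S : Set A}
    (hf : ∀ x, IsPolyFun k c (f x)) (hg : IsPolyFun k c g)
    (hS : ∀ a, a ∈ S ↔ g a ≠ 0 ∧ ∀ x, f x a = 0) : IsZariskiLocallyClosed k c S := by
  choose P hP using hf
  obtain ⟨Q, hQ⟩ := hg
  refine ⟨Set.range P, {Q}, Set.ext fun a => ?_⟩
  rw [hS]
  simp [principalOpen, ← hP, ← hQ, and_comm]

theorem isOpenIn {g : A → K} {S : Set A} (hg : IsPolyFun k c g) :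
    IsOpenIn k c {a | a ∈ S ∧ g a ≠ 0} S := by
  obtain ⟨Q, hQ⟩ := hg
  refine ⟨fun a ha => ha.1, fun a ha => ⟨Q, ?_, fun b hb => ⟨hb.1, ?_⟩⟩⟩
  · simpa [principalOpen, ← hQ] using ha.2
  · simpa [principalOpen, ← hQ] using hb.2

end IsPolyFun

/-! ### Linear algebra -/

/-- Rows in the span of the rows of `N` are given by a matrix of coefficients. -/
theorem exists_eq_mul_of_row_mem_span {K ι κ μ : Type*} [Field K] [Fintype κ]
    (M : Matrix ι μ K) (N : Matrix κ μ K)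
    (h : ∀ i, M.row i ∈ Submodule.span K (Set.range N.row)) :
    ∃ H : Matrix ι κ K, M = H * N := by
  simp only [Submodule.mem_span_range_iff_exists_fun] at h
  choose H hH using h
  refine ⟨Matrix.of H, ?_⟩
  ext i l
  have := congrFun (hH i) l
  simp [Matrix.row] at this
  simp [Matrix.mul_apply, this]

/-- Multiplication by an invertible matrix does not change the row space. -/
theorem span_row_mul_of_isUnit {K κ μ : Type*} [Field K] [Fintype κ] [DecidableEq κ]
    (H : Matrix κ κ K) (M : Matrix κ μ K) (hH : IsUnit H.det) :
    Submodule.span K (Set.range (H * M).row) = Submodule.span K (Set.range M.row) := by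
  have key : ∀ (H : Matrix κ κ K) (M : Matrix κ μ K),
      Submodule.span K (Set.range (H * M).row) ≤ Submodule.span K (Set.range M.row) := by
    intro H M
    rw [Submodule.span_le]
    rintro _ ⟨i, rfl⟩
    rw [SetLike.mem_coe, Submodule.mem_span_range_iff_exists_fun]
    refine ⟨H i, ?_⟩
    ext l
    simp [Matrix.row, Matrix.mul_apply]
  refine le_antisymm (key H M) ?_
  simpa [← Matrix.mul_assoc, Matrix.nonsing_inv_mul H hH] using key H⁻¹ (H * M)

/-- The determinant of a triangular matrix, for the order defined by an injective function. -/
theorem det_of_blockTriangular_injective {K ι α : Type*} [Field K] [Fintype ι] [DecidableEq ι]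
    [LinearOrder α] {b : ι → α} (hb : Function.Injective b) {g : Matrix ι ι K}
    (hg : g.BlockTriangular b) : g.det = ∏ i, g i i := by
  -- Ordering the indices through `b` turns block triangular into upper triangular.
  let _ := LinearOrder.lift' b hb
  convert Matrix.det_of_isUpperTriangular (M := g) fun i j hij => hg hij

/-- The row space of `X` lies in the orbit of a coordinate subspace under a triangular group if and
only if the corresponding minor is invertible and the normalized matrix is in echelon form. -/
theorem exists_blockTriangular_iff {K ι κ α : Type*} [Field K] [Fintype ι] [DecidableEq ι]
    [Fintype κ] [DecidableEq κ] [LinearOrder α] {b : ι → α} (hb : Function.Injective b)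
    {f : κ → ι} (hf : Function.Injective f) (X : Matrix κ ι K) :
    (∃ g : GL ι K, g.1.BlockTriangular b ∧ Submodule.span K (Set.range X.row) =
      (Submodule.span K (Set.range fun m => (Pi.single (f m) 1 : ι → K))).map g.1.mulVecLin) ↔
    (X.submatrix id f).det ≠ 0 ∧
      ∀ m l, b (f m) < b l → ((X.submatrix id f)⁻¹ * X) m l = 0 := by
  constructor
  · rintro ⟨g, hg, hX⟩
    have hgdet : g.1.det ≠ 0 := ((Matrix.isUnit_iff_isUnit_det _).1 g.isUnit).ne_zero
    -- The translated coordinate subspace is spanned by the columns of `g` at `f m`; `M` has them as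
    -- rows, which reverses the order of triangularity for its square part `T`.
    let M : Matrix κ ι K := Matrix.of fun m l => g.1 l (f m)
    have hM : Submodule.span K (Set.range X.row) = Submodule.span K (Set.range M.row) := by
      rw [hX, Submodule.map_span, ← Set.range_comp]
      congr 2
      ext m l
      simp [M, Matrix.row]
    let T := M.submatrix id f
    have hT : T.BlockTriangular (OrderDual.toDual ∘ b ∘ f) := fun i j hij => hg hij
    have hTdet : T.det ≠ 0 := by
      rw [det_of_blockTriangular_injective hb hg, Finset.prod_ne_zero_iff] at hgdet
      rw [det_of_blockTriangular_injective (OrderDual.toDual.injective.comp (hb.comp hf)) hT,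
        Finset.prod_ne_zero_iff]
      exact fun i _ => hgdet (f i) (Finset.mem_univ _)
    obtain ⟨H, hH⟩ := exists_eq_mul_of_row_mem_span X M fun i =>
      hM ▸ Submodule.subset_span ⟨i, rfl⟩
    obtain ⟨H', hH'⟩ := exists_eq_mul_of_row_mem_span M X fun i =>
      hM ▸ Submodule.subset_span ⟨i, rfl⟩
    have h1 : X.submatrix id f = H * T := by
      rw [hH]; rfl
    have h2 : T = H' * X.submatrix id f := by
      change M.submatrix id f = _
      rw [hH']; rfl
    have hXdet : (X.submatrix id f).det ≠ 0 := by
      intro h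
      apply hTdet
      rw [h2, Matrix.det_mul, h, mul_zero]
    have hHdet : H.det ≠ 0 := by
      intro h
      apply hXdet
      rw [h1, Matrix.det_mul, h, zero_mul]
    refine ⟨hXdet, fun m l hl => ?_⟩
    have hN : (X.submatrix id f)⁻¹ * X = T⁻¹ * M := by
      conv_lhs => rw [h1, Matrix.mul_inv_rev, hH]
      rw [Matrix.mul_assoc, Matrix.nonsing_inv_mul_cancel_left _ _ hHdet.isUnit]
    have : Invertible T := Matrix.invertibleOfIsUnitDet T hTdet.isUnit
    have hTinv := Matrix.blockTriangular_inv_of_blockTriangular hT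
    rw [hN, Matrix.mul_apply]
    refine Finset.sum_eq_zero fun m' _ => ?_
    -- In each summand one factor vanishes: that of `T⁻¹` if `m'` lies beyond `m`, otherwise that of
    -- `M`, since `l` then lies beyond `f m'`.
    rcases lt_or_ge (b (f m)) (b (f m')) with h | h
    · rw [hTinv (show OrderDual.toDual (b (f m')) < OrderDual.toDual (b (f m)) from h), zero_mul]
    · rw [show M m' l = 0 from hg (h.trans_lt hl), mul_zero]
  · rintro ⟨hdet, hz⟩
    set Y := (X.submatrix id f)⁻¹ * X with hY
    have hYf : ∀ m m', Y m (f m') = (1 : Matrix κ κ K) m m' := by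
      intro m m'
      rw [← Matrix.nonsing_inv_mul _ hdet.isUnit, hY]
      rfl
    -- The group element is the identity matrix with its columns at `f m` replaced by the rows of
    -- `Y`; its diagonal is 1.
    let g : Matrix ι ι K := Matrix.of fun l l' =>
      if h : ∃ m, f m = l' then Y h.choose l else (1 : Matrix ι ι K) l l'
    have hgf : ∀ l m, g l (f m) = Y m l := by
      intro l m
      have h : ∃ m', f m' = f m := ⟨m, rfl⟩
      simp only [g, Matrix.of_apply, dif_pos h]
      rw [hf h.choose_spec]
    have hgn : ∀ l l', (¬ ∃ m, f m = l') → g l l' = (1 : Matrix ι ι K) l l' := by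
      intro l l' h
      simp only [g, Matrix.of_apply, dif_neg h]
    have hg : g.BlockTriangular b := by
      intro l l' hl
      by_cases h : ∃ m, f m = l'
      · obtain ⟨m, rfl⟩ := h
        rw [hgf, hz m l hl]
      · rw [hgn _ _ h, Matrix.one_apply_ne]
        rintro rfl
        exact lt_irrefl _ hl
    have hgdet : g.det ≠ 0 := by
      rw [det_of_blockTriangular_injective hb hg, Finset.prod_ne_zero_iff]
      intro l _
      by_cases h : ∃ m, f m = l
      · obtain ⟨m, rfl⟩ := h
        simp [hgf, hYf]
      · simp [hgn _ _ h]
    refine ⟨Matrix.GeneralLinearGroup.mkOfDetNeZero g hgdet, hg, ?_⟩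
    rw [Submodule.map_span, ← Set.range_comp, ← span_row_mul_of_isUnit _ X
      (Matrix.isUnit_nonsing_inv_det _ hdet.isUnit)]
    congr 2
    ext m l
    have := hgf l m
    simp [Matrix.row, Matrix.GeneralLinearGroup.mkOfDetNeZero, this, ← hY]

/-- Independent rows, given at the places in `s`, can be completed to an invertible matrix by rows
of the identity matrix. -/
theorem exists_completion_det_ne_zero {K ι : Type*} [Field K] [Fintype ι] [DecidableEq ι]
    (v : ι → ι → K) (s : Finset ι) (hs : LinearIndepOn K v (s : Set ι)) :
    ∃ c : ι → ι,
      (Matrix.of fun m => if m ∈ s then v m else Pi.single (c m) 1 : Matrix ι ι K).det ≠ 0 := by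
  -- Induction on the number of missing rows: while one is missing, the span of the given rows is
  -- proper and so omits some basis vector, which can be added.
  obtain ⟨k, hk⟩ : ∃ k, k = sᶜ.card := ⟨_, rfl⟩
  induction k generalizing s v with
  | zero =>
    have hsu : s = Finset.univ := by
      rw [← compl_compl s, Finset.card_eq_zero.1 hk.symm, Finset.compl_empty]
    subst hsu
    refine ⟨id, ?_⟩
    rw [← isUnit_iff_ne_zero, ← Matrix.isUnit_iff_isUnit_det,
      ← Matrix.linearIndependent_rows_iff_isUnit]
    rw [Finset.coe_univ, linearIndepOn_univ_iff] at hs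
    simpa using hs
  | succ k ih =>
    classical
    obtain ⟨m, hm⟩ : ∃ m, m ∈ sᶜ := Finset.card_pos.1 (by omega)
    have hms : m ∉ s := Finset.mem_compl.1 hm
    obtain ⟨j, hj⟩ : ∃ j, (Pi.single j 1 : ι → K) ∉ Submodule.span K (v '' s) := by
      by_contra! hcon
      have htop : Submodule.span K (v '' (s : Set ι)) = ⊤ := by
        rw [eq_top_iff, ← (Pi.basisFun K ι).span_eq, Submodule.span_le]
        rintro _ ⟨j, rfl⟩
        simpa using hcon j
      have h1 : Module.finrank K (Submodule.span K (v '' (s : Set ι))) ≤ s.card := by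
        rw [← Finset.coe_image]
        exact (finrank_span_finset_le_card _).trans Finset.card_image_le
      rw [htop, finrank_top, Module.finrank_fintype_fun_eq_card] at h1
      have := Finset.card_compl_add_card s
      omega
    have hv' : LinearIndepOn K (Function.update v m (Pi.single j 1)) (s : Set ι) := by
      refine hs.congr fun i hi => ?_
      rw [Function.update_of_ne]
      rintro rfl
      exact hms hi
    have him : Function.update v m (Pi.single j 1) '' (s : Set ι) = v '' s := by
      refine Set.image_congr fun i hi => ?_
      rw [Function.update_of_ne]
      rintro rfl
      exact hms hi
    obtain ⟨c, hc⟩ := ih (Function.update v m (Pi.single j 1)) (insert m s)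
      (by
        rw [Finset.coe_insert]
        refine hv'.insert ?_
        rwa [him, Function.update_self])
      (by rw [Finset.compl_insert, Finset.card_erase_of_mem hm]; omega)
    refine ⟨Function.update c m j, ?_⟩
    convert hc using 3
    ext i l
    by_cases hi : i = m
    · subst hi
      simp [hms]
    · simp [hi]

/-! ### Echelon forms of the points of a Richardson variety -/

section Richardson

variable {K : Type*} [Field K] {d n : ℕ}

theorem coordSubspace_eq_span_range (I : Finset (Fin n)) (hI : I.card = d) :
    coordSubspace K I =
      Submodule.span K (Set.range fun m => (Pi.single (I.orderEmbOfFin hI m) 1 : Fin n → K)) := by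
  rw [coordSubspace, ← Finset.range_orderEmbOfFin I hI, ← Set.range_comp]
  rfl

theorem rowSpace_mem_openRichardson_iff (I J : Finset (Fin n)) (hI : I.card = d)
    (hJ : J.card = d) (X : FullRank K d n) :
    rowSpace X ∈ openRichardson K d I J ↔
      ((columnMinor X.1 I hI).det ≠ 0 ∧
        ∀ m l, l < I.orderEmbOfFin hI m → ((columnMinor X.1 I hI)⁻¹ * X.1) m l = 0) ∧
      ((columnMinor X.1 J hJ).det ≠ 0 ∧
        ∀ m l, J.orderEmbOfFin hJ m < l → ((columnMinor X.1 J hJ)⁻¹ * X.1) m l = 0) := by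
  refine and_congr ?_ ?_
  · rw [bruhatCellNeg, coordSubspace_eq_span_range I hI]
    -- Lower triangular means block triangular for the reversed order.
    exact exists_blockTriangular_iff (b := (OrderDual.toDual : Fin n → (Fin n)ᵒᵈ))
      OrderDual.toDual.injective (I.orderEmbOfFin hI).injective X.1
  · rw [bruhatCellPos, coordSubspace_eq_span_range J hJ]
    exact exists_blockTriangular_iff (b := (id : Fin n → Fin n))
      Function.injective_id (J.orderEmbOfFin hJ).injective X.1

/-- Matrices with the same row space differ by a factor on the left. -/
theorem exists_eq_mul_of_rowSpace_eq {X X' : FullRank K d n} (h : rowSpace X = rowSpace X') :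
    ∃ H : Matrix (Fin d) (Fin d) K, X.1 = H * X'.1 :=
  exists_eq_mul_of_row_mem_span _ _ fun i => by
    have h' : Submodule.span K (Set.range X.1.row) = Submodule.span K (Set.range X'.1.row) :=
      congrArg Subtype.val h
    exact h' ▸ Submodule.subset_span ⟨i, rfl⟩

theorem columnMinor_mul (H : Matrix (Fin d) (Fin d) K) (X : Matrix (Fin d) (Fin n) K)
    (I : Finset (Fin n)) (hI : I.card = d) :
    columnMinor (H * X) I hI = H * columnMinor X I hI := rfl

/-- A matrix with an invertible maximal minor has full rank. -/
theorem linearIndependent_row_of_columnMinor (X : Matrix (Fin d) (Fin n) K)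
    (J : Finset (Fin n)) (hJ : J.card = d) (h : (columnMinor X J hJ).det ≠ 0) :
    LinearIndependent K X.row := by
  apply LinearIndependent.of_comp (LinearMap.funLeft K K (J.orderEmbOfFin hJ))
  exact Matrix.linearIndependent_rows_iff_isUnit.2
    ((Matrix.isUnit_iff_isUnit_det _).2 h.isUnit)

/-- The representative of `W` whose columns indexed by `J` form the identity matrix. -/
noncomputable def normalForm (J : Finset (Fin n)) (hJ : J.card = d) (W : Gr K d n) :
    Matrix (Fin d) (Fin n) K :=
  let X := (Function.surjInv rowSpace_surjective W).1
  (columnMinor X J hJ)⁻¹ * X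

variable {I J : Finset (Fin n)} {hI : I.card = d} {hJ : J.card = d}

/-- Compares the chosen representative with an arbitrary `X`; the factor `H` then cancels from every
expression of the form $X_I^{-1}X$. -/
theorem exists_surjInv_eq_mul {X : FullRank K d n} (hX : rowSpace X ∈ openRichardson K d I J)
    (hI : I.card = d) (hJ : J.card = d) :
    ∃ H : Matrix (Fin d) (Fin d) K, H.det ≠ 0 ∧
      (Function.surjInv rowSpace_surjective (rowSpace X)).1 = H * X.1 := by
  have hs := Function.surjInv_eq rowSpace_surjective (rowSpace X)
  obtain ⟨H, hH⟩ := exists_eq_mul_of_rowSpace_eq hs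
  refine ⟨H, fun h => ?_, hH⟩
  rw [← hs, rowSpace_mem_openRichardson_iff I J hI hJ] at hX
  apply hX.2.1
  rw [hH, columnMinor_mul, Matrix.det_mul, h, zero_mul]

theorem normalForm_rowSpace {X : FullRank K d n} (hX : rowSpace X ∈ openRichardson K d I J)
    (hI : I.card = d) (hJ : J.card = d) :
    normalForm J hJ (rowSpace X) = (columnMinor X.1 J hJ)⁻¹ * X.1 := by
  obtain ⟨H, hH, h⟩ := exists_surjInv_eq_mul hX hI hJ
  simp only [normalForm]
  rw [h, columnMinor_mul, Matrix.mul_inv_rev, Matrix.mul_assoc,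
    Matrix.nonsing_inv_mul_cancel_left _ _ hH.isUnit]

theorem baseChange_rowSpace {X : FullRank K d n} (hX : rowSpace X ∈ openRichardson K d I J)
    (hI : I.card = d) (hJ : J.card = d) :
    baseChange I J hI hJ (rowSpace X) = (columnMinor X.1 I hI)⁻¹ * columnMinor X.1 J hJ := by
  obtain ⟨H, hH, h⟩ := exists_surjInv_eq_mul hX hI hJ
  simp only [baseChange]
  rw [h, columnMinor_mul, columnMinor_mul, Matrix.mul_inv_rev, Matrix.mul_assoc,
    Matrix.nonsing_inv_mul_cancel_left _ _ hH.isUnit]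

/-! ### The image of the base change map -/

/-- The equations and the inequality defining the image of the base change map. -/
def IsBaseChangeMatrix (I J : Finset (Fin n)) (hI : I.card = d) (hJ : J.card = d)
    (A : Matrix (Fin d) (Fin d) K) : Prop :=
  A.det ≠ 0 ∧
  (∀ m m', J.orderEmbOfFin hJ m < I.orderEmbOfFin hI m' → A.adjugate m m' = 0) ∧
  (∀ m m', J.orderEmbOfFin hJ m' < I.orderEmbOfFin hI m → A m m' = 0) ∧
  ∀ m m' m'', I.orderEmbOfFin hI m' = J.orderEmbOfFin hJ m'' →
    A m m'' = (1 : Matrix (Fin d) (Fin d) K) m m'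

/-- The definition uses the adjugate to keep its equations polynomial; dividing by the determinant
gives the form needed below. -/
theorem IsBaseChangeMatrix.inv_apply_eq_zero {A : Matrix (Fin d) (Fin d) K}
    (hA : IsBaseChangeMatrix I J hI hJ A) {m m' : Fin d}
    (h : J.orderEmbOfFin hJ m < I.orderEmbOfFin hI m') : A⁻¹ m m' = 0 := by
  rw [Matrix.inv_def, Matrix.smul_apply, hA.2.1 m m' h, smul_zero]

theorem isBaseChangeMatrix_baseChange {W : Gr K d n} (hW : W ∈ openRichardson K d I J)
    (hI : I.card = d) (hJ : J.card = d) :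
    IsBaseChangeMatrix I J hI hJ (baseChange I J hI hJ W) := by
  obtain ⟨X, rfl⟩ := rowSpace_surjective W
  rw [baseChange_rowSpace hW]
  obtain ⟨⟨hI0, hIz⟩, hJ0, hJz⟩ := (rowSpace_mem_openRichardson_iff I J hI hJ X).1 hW
  set A := (columnMinor X.1 I hI)⁻¹ * columnMinor X.1 J hJ with hA
  have hA0 : A.det ≠ 0 := by
    rw [hA, Matrix.det_mul]
    exact mul_ne_zero (Matrix.isUnit_nonsing_inv_det _ hI0.isUnit).ne_zero hJ0
  have hAinv : A⁻¹ = (columnMinor X.1 J hJ)⁻¹ * columnMinor X.1 I hI := by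
    rw [hA, Matrix.mul_inv_rev, Matrix.nonsing_inv_nonsing_inv _ hI0.isUnit]
  refine ⟨hA0, fun m m' h => ?_, fun m m' h => hIz m _ h, fun m m' m'' h => ?_⟩
  · have h1 : A⁻¹ m m' = 0 := by
      rw [hAinv]
      exact hJz m _ h
    rw [Matrix.inv_def, Matrix.smul_apply, smul_eq_mul, Ring.inverse_eq_inv'] at h1
    exact (mul_eq_zero.1 h1).resolve_left (inv_ne_zero hA0)
  · rw [← Matrix.nonsing_inv_mul _ hI0.isUnit]
    change ((columnMinor X.1 I hI)⁻¹ * X.1) m (J.orderEmbOfFin hJ m'') =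
      ((columnMinor X.1 I hI)⁻¹ * X.1) m (I.orderEmbOfFin hI m')
    rw [h]

/-- The matrix with the identity in the columns indexed by `J`, the inverse of `A` in those indexed
by `I`, and with the given vectors `z` as the other columns. -/
noncomputable def fillMatrix (I J : Finset (Fin n)) (hI : I.card = d) (hJ : J.card = d)
    (A : Matrix (Fin d) (Fin d) K) (z : Fin n → Fin d → K) : Matrix (Fin d) (Fin n) K :=
  Matrix.of fun m l =>
    if l ∈ J then if J.orderEmbOfFin hJ m = l then 1 else 0
    else if h : l ∈ I then A⁻¹ m ((I.orderIsoOfFin hI).symm ⟨l, h⟩) else z l m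

theorem fillMatrix_of_notMem (A : Matrix (Fin d) (Fin d) K) (z : Fin n → Fin d → K) (m : Fin d)
    {l : Fin n} (hlI : l ∉ I) (hlJ : l ∉ J) : fillMatrix I J hI hJ A z m l = z l m := by
  simp [fillMatrix, hlI, hlJ]

theorem columnMinor_fillMatrix_right (A : Matrix (Fin d) (Fin d) K) (z : Fin n → Fin d → K) :
    columnMinor (fillMatrix I J hI hJ A z) J hJ = 1 := by
  ext m m'
  simp [columnMinor, fillMatrix, Matrix.one_apply]

theorem columnMinor_fillMatrix_left {A : Matrix (Fin d) (Fin d) K}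
    (hA : IsBaseChangeMatrix I J hI hJ A) (z : Fin n → Fin d → K) :
    columnMinor (fillMatrix I J hI hJ A z) I hI = A⁻¹ := by
  ext m m'
  by_cases h : I.orderEmbOfFin hI m' ∈ J
  · obtain ⟨m'', hm⟩ : ∃ m'', J.orderEmbOfFin hJ m'' = I.orderEmbOfFin hI m' := by
      rwa [← Finset.mem_coe, ← Finset.range_orderEmbOfFin J hJ] at h
    have h1 : columnMinor (fillMatrix I J hI hJ A z) I hI m m' =
        columnMinor (fillMatrix I J hI hJ A z) J hJ m m'' := by
      simp [columnMinor, hm]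
    -- For a column in $I\cap J$ the two prescriptions agree: $Ae_{m''}=e_{m'}$ gives
    -- $A^{-1}e_{m'}=e_{m''}$.
    rw [h1, columnMinor_fillMatrix_right, ← Matrix.nonsing_inv_mul A hA.1.isUnit,
      Matrix.mul_apply]
    simp [fun a => hA.2.2.2 a m' m'' hm.symm, Matrix.one_apply]
  · have h2 : I.orderEmbOfFin hI m' ∈ I := Finset.orderEmbOfFin_mem I hI m'
    simp only [columnMinor, fillMatrix, Matrix.submatrix_apply, Matrix.of_apply, if_neg h,
      dif_pos h2, id]
    exact congrArg (A⁻¹ m) ((I.orderIsoOfFin hI).symm_apply_apply m')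

theorem linearIndependent_row_fillMatrix (I J : Finset (Fin n)) (hI : I.card = d)
    (hJ : J.card = d) (A : Matrix (Fin d) (Fin d) K) (z : Fin n → Fin d → K) :
    LinearIndependent K (fillMatrix I J hI hJ A z).row :=
  linearIndependent_row_of_columnMinor _ J hJ (by simp [columnMinor_fillMatrix_right])

/-- The point of the Grassmannian defined by `fillMatrix`. -/
noncomputable def fillPoint (I J : Finset (Fin n)) (hI : I.card = d) (hJ : J.card = d)
    (A : Matrix (Fin d) (Fin d) K) (z : Fin n → Fin d → K) : FullRank K d n :=
  ⟨fillMatrix I J hI hJ A z, linearIndependent_row_fillMatrix I J hI hJ A z⟩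

theorem exists_orderEmbOfFin_eq {l : Fin n} (h : l ∈ I) (hI : I.card = d) :
    ∃ m, I.orderEmbOfFin hI m = l := by
  rwa [← Finset.mem_coe, ← Finset.range_orderEmbOfFin I hI] at h

/-- Both echelon conditions are checked column by column. The filled matrix has columns $1$ in $J$
and $A^{-1}$ in $I$; after multiplication by $A$ these become $A$ and $1$. -/
theorem rowSpace_fillPoint_mem {A : Matrix (Fin d) (Fin d) K}
    (hA : IsBaseChangeMatrix I J hI hJ A) {z : Fin n → Fin d → K}
    (hz : ∀ l, l ∉ I → l ∉ J → ∀ m, J.orderEmbOfFin hJ m < l → z l m = 0)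
    (hAz : ∀ l, l ∉ I → l ∉ J → ∀ m, l < I.orderEmbOfFin hI m → A.mulVec (z l) m = 0) :
    rowSpace (fillPoint I J hI hJ A z) ∈ openRichardson K d I J := by
  have hcI := columnMinor_fillMatrix_left hA z
  have hcJ := columnMinor_fillMatrix_right (I := I) (J := J) (hI := hI) (hJ := hJ) A z
  rw [rowSpace_mem_openRichardson_iff I J hI hJ]
  simp only [fillPoint]
  rw [hcI, hcJ, Matrix.nonsing_inv_nonsing_inv _ hA.1.isUnit, inv_one, Matrix.one_mul]
  refine ⟨⟨(Matrix.isUnit_nonsing_inv_det _ hA.1.isUnit).ne_zero, fun m l hl => ?_⟩,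
    by simp, fun m l hl => ?_⟩
  · by_cases hlJ : l ∈ J
    · obtain ⟨m', rfl⟩ := exists_orderEmbOfFin_eq hlJ hJ
      change (columnMinor (A * fillMatrix I J hI hJ A z) J hJ) m m' = 0
      rw [columnMinor_mul, hcJ, Matrix.mul_one]
      exact hA.2.2.1 m m' hl
    · by_cases hlI : l ∈ I
      · obtain ⟨m', rfl⟩ := exists_orderEmbOfFin_eq hlI hI
        change (columnMinor (A * fillMatrix I J hI hJ A z) I hI) m m' = 0
        rw [columnMinor_mul, hcI, Matrix.mul_nonsing_inv _ hA.1.isUnit, Matrix.one_apply_ne]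
        rintro rfl
        exact lt_irrefl _ hl
      · rw [← hAz l hlI hlJ m hl]
        simp only [Matrix.mul_apply, Matrix.mulVec, dotProduct, fillMatrix_of_notMem _ _ _ hlI hlJ]
  · by_cases hlJ : l ∈ J
    · obtain ⟨m', rfl⟩ := exists_orderEmbOfFin_eq hlJ hJ
      change (columnMinor (fillMatrix I J hI hJ A z) J hJ) m m' = 0
      rw [hcJ, Matrix.one_apply_ne]
      rintro rfl
      exact lt_irrefl _ hl
    · by_cases hlI : l ∈ I
      · obtain ⟨m', rfl⟩ := exists_orderEmbOfFin_eq hlI hI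
        change (columnMinor (fillMatrix I J hI hJ A z) I hI) m m' = 0
        rw [hcI]
        exact hA.inv_apply_eq_zero hl
      · rw [fillMatrix_of_notMem _ _ _ hlI hlJ, hz l hlI hlJ m hl]

theorem baseChange_fillPoint {A : Matrix (Fin d) (Fin d) K}
    (hA : IsBaseChangeMatrix I J hI hJ A) {z : Fin n → Fin d → K}
    (hmem : rowSpace (fillPoint I J hI hJ A z) ∈ openRichardson K d I J) :
    baseChange I J hI hJ (rowSpace (fillPoint I J hI hJ A z)) = A := by
  rw [baseChange_rowSpace hmem]
  simp only [fillPoint]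
  rw [columnMinor_fillMatrix_left hA, columnMinor_fillMatrix_right,
    Matrix.nonsing_inv_nonsing_inv _ hA.1.isUnit, Matrix.mul_one]

theorem normalForm_fillPoint {A : Matrix (Fin d) (Fin d) K} {z : Fin n → Fin d → K}
    (hmem : rowSpace (fillPoint I J hI hJ A z) ∈ openRichardson K d I J) :
    normalForm J hJ (rowSpace (fillPoint I J hI hJ A z)) = fillMatrix I J hI hJ A z := by
  rw [normalForm_rowSpace hmem hI hJ]
  simp only [fillPoint]
  rw [columnMinor_fillMatrix_right, inv_one, Matrix.one_mul]

theorem image_baseChange (I J : Finset (Fin n)) (hI : I.card = d) (hJ : J.card = d)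
    (A : Matrix (Fin d) (Fin d) K) :
    A ∈ baseChange I J hI hJ '' openRichardson K d I J ↔ IsBaseChangeMatrix I J hI hJ A := by
  constructor
  · rintro ⟨W, hW, rfl⟩
    exact isBaseChangeMatrix_baseChange hW hI hJ
  · intro hA
    have hmem : rowSpace (fillPoint I J hI hJ A 0) ∈ openRichardson K d I J :=
      rowSpace_fillPoint_mem hA (by simp) (by simp)
    exact ⟨_, hmem, baseChange_fillPoint hA hmem⟩

/-- A point of the Richardson variety is recovered from its base change matrix and the columns of
its normal form outside of `I ∪ J`. -/
theorem rowSpace_fillPoint_normalForm {W : Gr K d n} (hW : W ∈ openRichardson K d I J)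
    {z : Fin n → Fin d → K}
    (hz : ∀ l, l ∉ I → l ∉ J → ∀ m, z l m = normalForm J hJ W m l) :
    rowSpace (fillPoint I J hI hJ (baseChange I J hI hJ W) z) = W := by
  obtain ⟨X, rfl⟩ := rowSpace_surjective W
  rw [baseChange_rowSpace hW]
  rw [normalForm_rowSpace hW hI hJ] at hz
  obtain ⟨⟨hI0, hIz⟩, hJ0, hJz⟩ := (rowSpace_mem_openRichardson_iff I J hI hJ X).1 hW
  have hfill : fillMatrix I J hI hJ ((columnMinor X.1 I hI)⁻¹ * columnMinor X.1 J hJ) z =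
      (columnMinor X.1 J hJ)⁻¹ * X.1 := by
    have hA := isBaseChangeMatrix_baseChange hW hI hJ
    rw [baseChange_rowSpace hW] at hA
    ext m l
    by_cases hlJ : l ∈ J
    · obtain ⟨m', rfl⟩ := exists_orderEmbOfFin_eq hlJ hJ
      change columnMinor (fillMatrix I J hI hJ _ z) J hJ m m' =
        ((columnMinor X.1 J hJ)⁻¹ * columnMinor X.1 J hJ) m m'
      rw [columnMinor_fillMatrix_right, Matrix.nonsing_inv_mul _ hJ0.isUnit]
    · by_cases hlI : l ∈ I
      · obtain ⟨m', rfl⟩ := exists_orderEmbOfFin_eq hlI hI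
        change columnMinor (fillMatrix I J hI hJ _ z) I hI m m' =
          ((columnMinor X.1 J hJ)⁻¹ * columnMinor X.1 I hI) m m'
        rw [columnMinor_fillMatrix_left hA, Matrix.mul_inv_rev,
          Matrix.nonsing_inv_nonsing_inv _ hI0.isUnit]
      · rw [fillMatrix_of_notMem _ _ _ hlI hlJ, hz l hlI hlJ]
  refine Subtype.ext ?_
  change Submodule.span K (Set.range (fillMatrix I J hI hJ _ z).row) = _
  rw [hfill, span_row_mul_of_isUnit _ _ (Matrix.isUnit_nonsing_inv_det _ hJ0.isUnit)]
  rfl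

/-! ### The fibres -/

/-- If there is a base change matrix, then `I ≤ J` in the Bruhat order. -/
theorem IsBaseChangeMatrix.le {A : Matrix (Fin d) (Fin d) K}
    (hA : IsBaseChangeMatrix I J hI hJ A) (m : Fin d) :
    I.orderEmbOfFin hI m ≤ J.orderEmbOfFin hJ m := by
  by_contra! hlt
  have hdet : A.adjugate.transpose.det ≠ 0 := by
    rw [Matrix.det_transpose, Matrix.det_adjugate]
    exact pow_ne_zero _ hA.1
  apply hdet
  rw [Matrix.det_apply]
  refine Finset.sum_eq_zero fun σ _ => ?_
  -- If $j_m<i_m$, the adjugate has a zero block in rows up to `m` and columns from `m` on. By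
  -- pigeonhole every permutation meets this block, so the determinant vanishes.
  obtain ⟨a, ha, hσa⟩ : ∃ a, a ≤ m ∧ m ≤ σ a := by
    by_contra! hcon
    have := Finset.card_le_card_of_injOn (s := Finset.Iic m) (t := Finset.Iio m) σ
      (fun a ha => by simpa using hcon a (by simpa using ha)) σ.injective.injOn
    simp at this
  rw [Finset.prod_eq_zero (Finset.mem_univ a), smul_zero]
  exact hA.2.1 _ _ ((((J.orderEmbOfFin hJ).monotone ha).trans_lt hlt).trans_le
    ((I.orderEmbOfFin hI).monotone hσa))

/-- The linear conditions on a column at `l` of the normal form are independent. -/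
theorem IsBaseChangeMatrix.eq_zero_of_add_vecMul_eq_zero {A : Matrix (Fin d) (Fin d) K}
    (hA : IsBaseChangeMatrix I J hI hJ A) (l : Fin n) {α β : Fin d → K}
    (hα : ∀ m, α m ≠ 0 → J.orderEmbOfFin hJ m < l)
    (hβ : ∀ m, β m ≠ 0 → l < I.orderEmbOfFin hI m) (h : α + Matrix.vecMul β A = 0) :
    α = 0 ∧ β = 0 := by
  have h1 : β = - Matrix.vecMul α A⁻¹ := by
    rw [← Matrix.neg_vecMul, neg_eq_of_add_eq_zero_right h, Matrix.vecMul_vecMul,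
      Matrix.mul_nonsing_inv _ hA.1.isUnit, Matrix.vecMul_one]
  have h2 : β = 0 := by
    ext m'
    by_contra hm'
    apply hm'
    rw [h1, Pi.neg_apply, Pi.zero_apply, neg_eq_zero, Matrix.vecMul, dotProduct]
    refine Finset.sum_eq_zero fun m _ => ?_
    by_cases hm : α m = 0
    · rw [hm, zero_mul]
    · rw [hA.inv_apply_eq_zero ((hα m hm).trans (hβ m' hm')), mul_zero]
  refine ⟨?_, h2⟩
  rwa [h2, Matrix.zero_vecMul, add_zero] at h

/-- The linear conditions on a column at `l` of the normal form, completed by the coordinates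
chosen by `c`. -/
def columnSystem (I J : Finset (Fin n)) (hI : I.card = d) (hJ : J.card = d)
    (c : Fin n → Fin d → Fin d) (A : Matrix (Fin d) (Fin d) K) (l : Fin n) :
    Matrix (Fin d) (Fin d) K :=
  Matrix.of fun m =>
    if J.orderEmbOfFin hJ m < l then Pi.single m 1
    else if l < I.orderEmbOfFin hI m then A m else Pi.single (c l m) 1

theorem IsBaseChangeMatrix.exists_columnSystem {A : Matrix (Fin d) (Fin d) K}
    (hA : IsBaseChangeMatrix I J hI hJ A) :
    ∃ c : Fin n → Fin d → Fin d, ∀ l, (columnSystem I J hI hJ c A l).det ≠ 0 := by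
  have key : ∀ l, ∃ c : Fin d → Fin d,
      (columnSystem I J hI hJ (fun _ => c) A l).det ≠ 0 := by
    intro l
    obtain ⟨c, hc⟩ := exists_completion_det_ne_zero
      (fun m => if J.orderEmbOfFin hJ m < l then (Pi.single m 1 : Fin d → K) else A m)
      (Finset.univ.filter fun m => J.orderEmbOfFin hJ m < l ∨ l < I.orderEmbOfFin hI m) (by
        rw [linearIndepOn_finset_iff]
        intro f hf
        obtain ⟨hα, hβ⟩ := hA.eq_zero_of_add_vecMul_eq_zero l
          -- A relation among the rows is split into its unit vector part `α` and its part `β` on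
          -- rows of `A`.
          (α := fun m => if J.orderEmbOfFin hJ m < l then f m else 0)
          (β := fun m => if J.orderEmbOfFin hJ m < l then 0
            else if l < I.orderEmbOfFin hI m then f m else 0)
          (fun m hm => by
            by_contra h
            simp [h] at hm)
          (fun m hm => by
            by_contra h
            simp [h] at hm)
          (by
            rw [← hf, Finset.sum_filter]
            ext x
            simp only [Pi.add_apply, Matrix.vecMul, dotProduct, Finset.sum_apply]
            have hx : (if J.orderEmbOfFin hJ x < l then f x else 0) =
                ∑ m, (if J.orderEmbOfFin hJ m < l then f m else 0) *
                  (Pi.single m 1 : Fin d → K) x := by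
              simp [Pi.single_apply]
            rw [hx, ← Finset.sum_add_distrib]
            refine Finset.sum_congr rfl fun m _ => ?_
            by_cases h1 : J.orderEmbOfFin hJ m < l <;>
              by_cases h2 : l < I.orderEmbOfFin hI m <;> simp [h1, h2])
        intro m hm
        have h1 := congrFun hα m
        have h2 := congrFun hβ m
        by_cases h : J.orderEmbOfFin hJ m < l
        · simpa [h] using h1
        · simpa [h, (Finset.mem_filter.1 hm).2.resolve_left h] using h2)
    refine ⟨c, ?_⟩
    convert hc using 3
    ext m : 1
    by_cases h1 : J.orderEmbOfFin hJ m < l <;>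
      by_cases h2 : l < I.orderEmbOfFin hI m <;> simp [columnSystem, h1, h2]
  choose c hc using key
  exact ⟨c, hc⟩

theorem columnSystem_mulVec (c : Fin n → Fin d → Fin d) (A : Matrix (Fin d) (Fin d) K)
    (l : Fin n) (y : Fin d → K) (m : Fin d) :
    (columnSystem I J hI hJ c A l).mulVec y m =
      if J.orderEmbOfFin hJ m < l then y m
      else if l < I.orderEmbOfFin hI m then A.mulVec y m else y (c l m) := by
  simp only [Matrix.mulVec, columnSystem, Matrix.of_apply]
  split_ifs <;> simp

/-- The index set of the coordinates on the fibres. -/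
def freeEntries (I J : Finset (Fin n)) (hI : I.card = d) (hJ : J.card = d) :
    Finset (Fin d × Fin n) :=
  Finset.univ.filter fun p : Fin d × Fin n =>
    p.2 ∉ I ∪ J ∧ I.orderEmbOfFin hI p.1 < p.2 ∧ p.2 < J.orderEmbOfFin hJ p.1

/-- The right hand side of the linear system for the column at `l`. -/
noncomputable def freeVector (v : Fin (freeEntries I J hI hJ).card → K) (l : Fin n)
    (m : Fin d) : K :=
  if h : (m, l) ∈ freeEntries I J hI hJ then v ((freeEntries I J hI hJ).equivFin ⟨(m, l), h⟩)
  else 0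

/-- The columns of the normal form with given coordinates on the fibre. -/
noncomputable def freeColumn (c : Fin n → Fin d → Fin d) (A : Matrix (Fin d) (Fin d) K)
    (v : Fin (freeEntries I J hI hJ).card → K) (l : Fin n) : Fin d → K :=
  (columnSystem I J hI hJ c A l)⁻¹.mulVec (freeVector v l)

theorem freeColumn_eq_iff {c : Fin n → Fin d → Fin d} {A : Matrix (Fin d) (Fin d) K} {l : Fin n}
    (h : (columnSystem I J hI hJ c A l).det ≠ 0) (v : Fin (freeEntries I J hI hJ).card → K)
    (y : Fin d → K) :
    freeColumn c A v l = y ↔ (columnSystem I J hI hJ c A l).mulVec y = freeVector v l := by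
  constructor
  · rintro rfl
    rw [freeColumn, Matrix.mulVec_mulVec, Matrix.mul_nonsing_inv _ h.isUnit, Matrix.one_mulVec]
  · intro hy
    rw [freeColumn, ← hy, Matrix.mulVec_mulVec, Matrix.nonsing_inv_mul _ h.isUnit,
      Matrix.one_mulVec]

end Richardson

/-! ### The local trivializations -/

section Trivialization

variable {k K : Type*} [Field k] [Field K] [Algebra k K] {d n : ℕ}
  {I J : Finset (Fin n)} {hI : I.card = d} {hJ : J.card = d}

theorem isPolyFun_columnMinor (I : Finset (Fin n)) (hI : I.card = d) (i j : Fin d) :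
    IsPolyFun k (fullRankCoord (K := K) (d := d) (n := n))
      fun X => columnMinor X.1 I hI i j :=
  .coord (i, I.orderEmbOfFin hI j)

theorem isPolyFun_entry (i : Fin d) (j : Fin n) :
    IsPolyFun k (fullRankCoord (K := K) (d := d) (n := n)) fun X => X.1 i j :=
  .coord (i, j)

theorem isPolyFun_columnSystem {A σ : Type*} {c : A → σ → K} {M : A → Matrix (Fin d) (Fin d) K}
    (hM : ∀ i j, IsPolyFun k c fun a => M a i j) (e : Fin n → Fin d → Fin d) (l : Fin n)
    (i j : Fin d) : IsPolyFun k c fun a => columnSystem I J hI hJ e (M a) l i j := by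
  simp only [columnSystem, Matrix.of_apply]
  split_ifs
  · simp only [Pi.single_apply]
    exact .ite .one .zero
  · exact hM i j
  · simp only [Pi.single_apply]
    exact .ite .one .zero

/-! ### Local closedness and regularity -/

theorem isLocallyClosedGr_openRichardson (I J : Finset (Fin n)) (hI : I.card = d)
    (hJ : J.card = d) : IsLocallyClosedGr k (openRichardson K d I J) := by
  refine IsPolyFun.isZariskiLocallyClosed
    (f := fun (x : (Fin d × Fin n) ⊕ (Fin d × Fin n)) (X : FullRank K d n) => x.elim
      (fun p => if p.2 < I.orderEmbOfFin hI p.1 then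
        ((columnMinor X.1 I hI).adjugate * X.1) p.1 p.2 else 0)
      (fun p => if J.orderEmbOfFin hJ p.1 < p.2 then
        ((columnMinor X.1 J hJ).adjugate * X.1) p.1 p.2 else 0))
    (g := fun X => (columnMinor X.1 I hI).det * (columnMinor X.1 J hJ).det)
    ?_ ((IsPolyFun.det (isPolyFun_columnMinor I hI)).mul
      (IsPolyFun.det (isPolyFun_columnMinor J hJ))) fun X => ?_
  · rintro (p | p)
    · exact .ite (.mulApply (.adjugate (isPolyFun_columnMinor I hI)) isPolyFun_entry _ _) .zero
    · exact .ite (.mulApply (.adjugate (isPolyFun_columnMinor J hJ)) isPolyFun_entry _ _) .zero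
  -- Where the minors are invertible, replacing inverses by adjugates makes the echelon conditions
  -- polynomial.
  · have key : ∀ M : Matrix (Fin d) (Fin d) K, M.det ≠ 0 → ∀ m l,
        ((M⁻¹ * X.1) m l = 0 ↔ (M.adjugate * X.1) m l = 0) := by
      intro M hM m l
      rw [Matrix.inv_def, Matrix.smul_mul, Matrix.smul_apply, smul_eq_mul, mul_eq_zero,
        Ring.inverse_eq_inv', or_iff_right (inv_ne_zero hM)]
    rw [Set.mem_preimage, rowSpace_mem_openRichardson_iff I J hI hJ, mul_ne_zero_iff,
      and_and_and_comm]
    refine and_congr_right fun h => ?_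
    simp only [Sum.forall, Sum.elim_inl, Sum.elim_inr, Prod.forall, ite_eq_right_iff,
      key _ h.1, key _ h.2]

theorem isZariskiLocallyClosed_image_baseChange (I J : Finset (Fin n)) (hI : I.card = d)
    (hJ : J.card = d) : IsZariskiLocallyClosed k matrixCoord
      (baseChange I J hI hJ '' openRichardson K d I J) := by
  have hM : ∀ i j, IsPolyFun k matrixCoord fun A : Matrix (Fin d) (Fin d) K => A i j :=
    fun i j => .coord (i, j)
  refine IsPolyFun.isZariskiLocallyClosed
    (f := fun (x : (Fin d × Fin d) ⊕ (Fin d × Fin d) ⊕ (Fin d × Fin d × Fin d))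
      (A : Matrix (Fin d) (Fin d) K) => x.elim
      (fun p => if J.orderEmbOfFin hJ p.1 < I.orderEmbOfFin hI p.2 then
        A.adjugate p.1 p.2 else 0) (fun x => x.elim
      (fun p => if J.orderEmbOfFin hJ p.2 < I.orderEmbOfFin hI p.1 then A p.1 p.2 else 0)
      (fun p => if I.orderEmbOfFin hI p.2.1 = J.orderEmbOfFin hJ p.2.2 then
        A p.1 p.2.2 - (1 : Matrix (Fin d) (Fin d) K) p.1 p.2.1 else 0)))
    (g := Matrix.det) ?_ (IsPolyFun.det hM) fun A => ?_
  · rintro (p | p | p)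
    · exact .ite (.adjugate hM _ _) .zero
    · exact .ite (hM _ _) .zero
    · refine .ite ((hM _ _).sub ?_) .zero
      simp only [Matrix.one_apply]
      exact .ite .one .zero
  · rw [image_baseChange, IsBaseChangeMatrix]
    simp only [Sum.forall, Sum.elim_inl, Sum.elim_inr, Prod.forall, ite_eq_right_iff, sub_eq_zero]

theorem isRegularOnGr_baseChange (I J : Finset (Fin n)) (hI : I.card = d) (hJ : J.card = d)
    (i j : Fin d) :
    IsRegularOnGr k (openRichardson K d I J) fun W => baseChange I J hI hJ W i j := by
  intro X hX
  have h := IsPolyFun.isRegularOn_inv_mul (k := k) (S := rowSpace ⁻¹' openRichardson K d I J)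
    (isPolyFun_columnMinor (K := K) I hI) (isPolyFun_columnMinor J hJ)
    (fun X hX => ((rowSpace_mem_openRichardson_iff I J hI hJ X).1 hX).1.1) i j X hX
  obtain ⟨P, Q, hQ, hPQ⟩ := h
  refine ⟨P, Q, hQ, fun b hb => ?_⟩
  rw [← hPQ b hb, Function.comp_apply, baseChange_rowSpace hb.1]

theorem IsRegularOnGr.mono {S T : Set (Gr K d n)} {f : Gr K d n → K} (h : IsRegularOnGr k T f)
    (hST : S ⊆ T) : IsRegularOnGr k S f := fun X hX =>
  let ⟨P, Q, hQ, hPQ⟩ := h X (hST hX)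
  ⟨P, Q, hQ, fun b hb => hPQ b ⟨hST hb.1, hb.2⟩⟩

theorem isRegularOnGr_normalForm (I J : Finset (Fin n)) (hI : I.card = d) (hJ : J.card = d)
    (i : Fin d) (j : Fin n) :
    IsRegularOnGr k (openRichardson K d I J) fun W => normalForm J hJ W i j := by
  intro X hX
  have h := IsPolyFun.isRegularOn_inv_mul (k := k) (S := rowSpace ⁻¹' openRichardson K d I J)
    (isPolyFun_columnMinor (K := K) J hJ) isPolyFun_entry
    (fun X hX => ((rowSpace_mem_openRichardson_iff I J hI hJ X).1 hX).2.1) i j X hX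
  obtain ⟨P, Q, hQ, hPQ⟩ := h
  refine ⟨P, Q, hQ, fun b hb => ?_⟩
  rw [← hPQ b hb, Function.comp_apply, normalForm_rowSpace hb.1 hI hJ]

/-! ### Solving for the columns, and the transition maps -/

/-- The open set over which the columns are parametrized by the coordinates chosen by `c`. -/
def trivializationBase (I J : Finset (Fin n)) (hI : I.card = d) (hJ : J.card = d)
    (c : Fin n → Fin d → Fin d) : Set (Matrix (Fin d) (Fin d) K) :=
  {A | A ∈ baseChange I J hI hJ '' openRichardson K d I J ∧
    ∏ l, (columnSystem I J hI hJ c A l).det ≠ 0}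

theorem trivializationBase.isBaseChangeMatrix {c : Fin n → Fin d → Fin d}
    {A : Matrix (Fin d) (Fin d) K} (hA : A ∈ trivializationBase I J hI hJ c) :
    IsBaseChangeMatrix I J hI hJ A :=
  (image_baseChange I J hI hJ A).1 hA.1

theorem trivializationBase.det_columnSystem_ne_zero {c : Fin n → Fin d → Fin d}
    {A : Matrix (Fin d) (Fin d) K} (hA : A ∈ trivializationBase I J hI hJ c) (l : Fin n) :
    (columnSystem I J hI hJ c A l).det ≠ 0 :=
  Finset.prod_ne_zero_iff.1 hA.2 l (Finset.mem_univ l)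

theorem columnSystem_mulVec_freeColumn {c : Fin n → Fin d → Fin d}
    {A : Matrix (Fin d) (Fin d) K} (hA : A ∈ trivializationBase I J hI hJ c)
    (v : Fin (freeEntries I J hI hJ).card → K) (l : Fin n) (m : Fin d) :
    (if J.orderEmbOfFin hJ m < l then freeColumn c A v l m
      else if l < I.orderEmbOfFin hI m then A.mulVec (freeColumn c A v l) m
      else freeColumn c A v l (c l m)) = freeVector v l m := by
  rw [← columnSystem_mulVec, (freeColumn_eq_iff
    (trivializationBase.det_columnSystem_ne_zero hA l) v _).1 rfl]

theorem freeVector_eq_zero {v : Fin (freeEntries I J hI hJ).card → K} {l : Fin n} {m : Fin d}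
    (h : ¬ (I.orderEmbOfFin hI m < l ∧ l < J.orderEmbOfFin hJ m)) : freeVector v l m = 0 :=
  dif_neg fun hm => h (Finset.mem_filter.1 hm).2.2

theorem freeVector_apply (v : Fin (freeEntries I J hI hJ).card → K)
    (p : Fin (freeEntries I J hI hJ).card) :
    freeVector v ((freeEntries I J hI hJ).equivFin.symm p).1.2
      ((freeEntries I J hI hJ).equivFin.symm p).1.1 = v p := by
  rw [freeVector, dif_pos ((freeEntries I J hI hJ).equivFin.symm p).2]
  simp

theorem rowSpace_freeColumn_mem {c : Fin n → Fin d → Fin d}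
    {A : Matrix (Fin d) (Fin d) K} (hA : A ∈ trivializationBase I J hI hJ c)
    (v : Fin (freeEntries I J hI hJ).card → K) :
    rowSpace (fillPoint I J hI hJ A (freeColumn c A v)) ∈ openRichardson K d I J := by
  have hA' := trivializationBase.isBaseChangeMatrix hA
  refine rowSpace_fillPoint_mem hA' (fun l _ _ m hm => ?_) (fun l _ _ m hm => ?_)
  · have h := columnSystem_mulVec_freeColumn hA v l m
    rwa [if_pos hm, freeVector_eq_zero fun h => lt_asymm h.2 hm] at h
  · have h := columnSystem_mulVec_freeColumn hA v l m
    -- Here $i_m\le j_m$ ensures that the equation for $I$ is not hidden by the first case of the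
    -- system.
    rwa [if_neg (hm.trans_le (hA'.le m)).not_gt, if_pos hm,
      freeVector_eq_zero fun h => lt_asymm h.1 hm] at h

theorem normalForm_freeColumn {c : Fin n → Fin d → Fin d}
    {A : Matrix (Fin d) (Fin d) K} (hA : A ∈ trivializationBase I J hI hJ c)
    (v : Fin (freeEntries I J hI hJ).card → K) (p : Fin (freeEntries I J hI hJ).card)
    (m : Fin d) :
    normalForm J hJ (rowSpace (fillPoint I J hI hJ A (freeColumn c A v))) m
      ((freeEntries I J hI hJ).equivFin.symm p).1.2 =
    freeColumn c A v ((freeEntries I J hI hJ).equivFin.symm p).1.2 m := by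
  have hp := (Finset.mem_filter.1 ((freeEntries I J hI hJ).equivFin.symm p).2).2.1
  rw [Finset.notMem_union] at hp
  rw [normalForm_fillPoint (rowSpace_freeColumn_mem hA v), fillMatrix_of_notMem _ _ _ hp.1 hp.2]

/-- The columns of the normal form of a point solve the linear systems. -/
theorem freeColumn_eq_normalForm {c : Fin n → Fin d → Fin d} {W : Gr K d n}
    (hW : W ∈ openRichardson K d I J)
    (hA : baseChange I J hI hJ W ∈ trivializationBase I J hI hJ c)
    {l : Fin n} (hlI : l ∉ I) (hlJ : l ∉ J) :
    freeColumn c (baseChange I J hI hJ W)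
      (fun p => normalForm J hJ W
        (c ((freeEntries I J hI hJ).equivFin.symm p).1.2
          ((freeEntries I J hI hJ).equivFin.symm p).1.1)
        ((freeEntries I J hI hJ).equivFin.symm p).1.2) l =
    fun m => normalForm J hJ W m l := by
  rw [freeColumn_eq_iff (trivializationBase.det_columnSystem_ne_zero hA l)]
  ext m
  rw [columnSystem_mulVec]
  obtain ⟨X, rfl⟩ := rowSpace_surjective W
  obtain ⟨⟨hI0, hIz⟩, hJ0, hJz⟩ := (rowSpace_mem_openRichardson_iff I J hI hJ X).1 hW
  by_cases h1 : J.orderEmbOfFin hJ m < l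
  · rw [if_pos h1, freeVector_eq_zero fun h => lt_asymm h.2 h1, normalForm_rowSpace hW hI hJ,
      hJz m l h1]
  rw [if_neg h1]
  by_cases h2 : l < I.orderEmbOfFin hI m
  · rw [if_pos h2, freeVector_eq_zero fun h => lt_asymm h.1 h2, normalForm_rowSpace hW hI hJ,
      baseChange_rowSpace hW]
    -- This is $AY=X_I^{-1}X$, which turns the echelon condition for `I` into one on $Ay_l$.
    have h3 : (columnMinor X.1 I hI)⁻¹ * columnMinor X.1 J hJ *
        ((columnMinor X.1 J hJ)⁻¹ * X.1) = (columnMinor X.1 I hI)⁻¹ * X.1 := by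
      rw [Matrix.mul_assoc, Matrix.mul_nonsing_inv_cancel_left _ _ hJ0.isUnit]
    rw [← hIz m l h2, ← h3, Matrix.mul_apply (M := _ * _)]
    rfl
  -- Since $l\notin I\cup J$, both remaining inequalities are strict.
  · have hm : (m, l) ∈ freeEntries I J hI hJ := by
      refine Finset.mem_filter.2 ⟨Finset.mem_univ _, by simp [hlI, hlJ], ?_, ?_⟩
      · refine lt_of_le_of_ne (not_lt.1 h2) ?_
        exact fun h : _ = l => hlI (h ▸ Finset.orderEmbOfFin_mem I hI m)
      · refine lt_of_le_of_ne (not_lt.1 h1) ?_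
        exact fun h : l = _ => hlJ (h ▸ Finset.orderEmbOfFin_mem J hJ m)
    rw [if_neg h2, freeVector, dif_pos hm]
    simp

theorem isRegularToGr_freeColumn (c : Fin n → Fin d → Fin d) :
    IsRegularToGr k (K := K) prodCoord (trivializationBase I J hI hJ c ×ˢ Set.univ)
      fun x => rowSpace (fillPoint I J hI hJ x.1
        (freeColumn (I := I) (J := J) (hI := hI) (hJ := hJ) c x.1 x.2)) := by
  refine fun a _ => ⟨1, by simp [principalOpen], fun x => fillPoint I J hI hJ x.1
    (freeColumn (I := I) (J := J) (hI := hI) (hJ := hJ) c x.1 x.2), fun m l => ?_, fun b _ => rfl⟩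
  have hM : ∀ i j, IsPolyFun k prodCoord
      fun x : Matrix (Fin d) (Fin d) K × (Fin (freeEntries I J hI hJ).card → K) => x.1 i j :=
    fun i j => .coord (Sum.inl (i, j))
  simp only [fillPoint, fillMatrix, Matrix.of_apply]
  split_ifs with h1 h2 h3
  · exact IsPolyFun.one.isRegularOn
  · exact IsPolyFun.zero.isRegularOn
  · have h := IsPolyFun.isRegularOn_inv_mul (S := (trivializationBase I J hI hJ c ×ˢ Set.univ) ∩
        principalOpen prodCoord (1 : MvPolynomial _ k)) hM
      (N := fun _ => (1 : Matrix (Fin d) (Fin d) K)) (fun i j => by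
        simp only [Matrix.one_apply]
        exact .ite .one .zero)
      (fun x hx => (trivializationBase.isBaseChangeMatrix hx.1.1).1) m
      ((I.orderIsoOfFin hI).symm ⟨l, h3⟩)
    simpa only [Matrix.mul_one] using h
  · refine IsPolyFun.isRegularOn_inv_mulVec (isPolyFun_columnSystem hM c l) (fun i => ?_)
      (fun x hx => trivializationBase.det_columnSystem_ne_zero hx.1.1 l) m
    simp only [freeVector]
    split_ifs with h
    · exact .coord (Sum.inr ((freeEntries I J hI hJ).equivFin ⟨(i, l), h⟩))
    · exact .zero

/-- The trivialization of the base change map with the fibre coordinates chosen by `c`. -/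
noncomputable def baseChangeTrivialization (k : Type*) {K : Type*} [Field k] [Field K]
    [Algebra k K] (I J : Finset (Fin n)) (hI : I.card = d) (hJ : J.card = d)
    (c : Fin n → Fin d → Fin d) :
    LocalTrivialization k (openRichardson K d I J)
      (baseChange I J hI hJ '' openRichardson K d I J) (baseChange I J hI hJ)
      (freeEntries I J hI hJ).card where
  U := trivializationBase I J hI hJ c
  isOpen_U := IsPolyFun.isOpenIn (.prod _ fun l => .det
    (isPolyFun_columnSystem (fun i j => .coord (i, j)) c l))
  coord W p := normalForm J hJ W
    (c ((freeEntries I J hI hJ).equivFin.symm p).1.2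
      ((freeEntries I J hI hJ).equivFin.symm p).1.1)
    ((freeEntries I J hI hJ).equivFin.symm p).1.2
  point x := rowSpace (fillPoint I J hI hJ x.1 (freeColumn c x.1 x.2))
  regular_coord p := (isRegularOnGr_normalForm I J hI hJ _ _).mono Set.inter_subset_left
  regular_point := isRegularToGr_freeColumn c
  point_mem A hA v := rowSpace_freeColumn_mem hA v
  proj_point A hA v := baseChange_fillPoint (trivializationBase.isBaseChangeMatrix hA)
    (rowSpace_freeColumn_mem hA v)
  coord_point A hA v := by
    ext p
    have hp := (Finset.mem_filter.1 ((freeEntries I J hI hJ).equivFin.symm p).2).2.2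
    -- At a free index the row of the system reads off the entry chosen by `c`, and its right hand
    -- side is the coordinate of `v`.
    rw [normalForm_freeColumn hA, ← freeVector_apply v p, ← columnSystem_mulVec_freeColumn hA,
      if_neg hp.2.not_gt, if_neg hp.1.not_gt]
  point_coord W hW hA := rowSpace_fillPoint_normalForm hW fun l hlI hlJ m =>
    congrFun (freeColumn_eq_normalForm hW hA hlI hlJ) m

theorem isVectorBundle_baseChange (k : Type*) {K : Type*} [Field k] [Field K] [Algebra k K]
    (I J : Finset (Fin n)) (hI : I.card = d) (hJ : J.card = d) :
    IsVectorBundle k (openRichardson K d I J)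
      (baseChange I J hI hJ '' openRichardson K d I J) (baseChange I J hI hJ)
      (freeEntries I J hI hJ).card := by
  refine ⟨Set.mapsTo_image _ _, isRegularOnGr_baseChange I J hI hJ,
    Set.range (baseChangeTrivialization k I J hI hJ), fun A hA => ?_, ?_⟩
  · obtain ⟨c, hc⟩ := ((image_baseChange I J hI hJ A).1 hA).exists_columnSystem
    exact ⟨_, ⟨c, rfl⟩, hA, Finset.prod_ne_zero_iff.2 fun l _ => hc l⟩
  · rintro _ ⟨c, rfl⟩ _ ⟨c', rfl⟩ A ⟨hA, -⟩
    -- The transition solves the system of `c` and reads off the entry chosen by `c'`; with `A`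
    -- fixed, `v` enters only through the right hand side, linearly.
    have key : ∀ (v : Fin (freeEntries I J hI hJ).card → K) (p),
        (baseChangeTrivialization k I J hI hJ c').coord
          ((baseChangeTrivialization k I J hI hJ c).point (A, v)) p =
        (columnSystem I J hI hJ c A ((freeEntries I J hI hJ).equivFin.symm p).1.2)⁻¹.mulVec
          (freeVector v ((freeEntries I J hI hJ).equivFin.symm p).1.2)
          (c' ((freeEntries I J hI hJ).equivFin.symm p).1.2
            ((freeEntries I J hI hJ).equivFin.symm p).1.1) :=
      fun v p => normalForm_freeColumn hA v p _
    have hadd : ∀ (v w : Fin (freeEntries I J hI hJ).card → K) (l),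
        freeVector (v + w) l = freeVector v l + freeVector w l := by
      intro v w l
      ext m
      simp only [freeVector, Pi.add_apply]
      split_ifs <;> simp
    have hsmul : ∀ (a : K) (v : Fin (freeEntries I J hI hJ).card → K) (l),
        freeVector (a • v) l = a • freeVector v l := by
      intro a v l
      ext m
      simp only [freeVector, Pi.smul_apply]
      split_ifs <;> simp
    refine ⟨fun v w => ?_, fun a v => ?_⟩
    · ext p
      rw [Pi.add_apply, key, key, key, hadd, Matrix.mulVec_add, Pi.add_apply]
    · ext p
      rw [Pi.smul_apply, key, key, hsmul, Matrix.mulVec_smul, Pi.smul_apply]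

end Trivialization

theorem mainTheorem3 (k : Type*) {K : Type*} [Field k] [Field K] [Algebra k K] {d n : ℕ}
    (I J : Finset (Fin n)) (hI : I.card = d) (hJ : J.card = d) :
    -- the base change map is well defined, with values in `GL_d`
    (∀ X : FullRank K d n, rowSpace X ∈ openRichardson K d I J →
      IsUnit (columnMinor X.1 I hI).det ∧ IsUnit (columnMinor X.1 J hJ).det ∧
      baseChange I J hI hJ (rowSpace X) = (columnMinor X.1 I hI)⁻¹ * columnMinor X.1 J hJ) ∧
    -- source and image are locally closed subvarieties
    IsLocallyClosedGr k (openRichardson K d I J) ∧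
    IsZariskiLocallyClosed k matrixCoord (baseChange I J hI hJ '' openRichardson K d I J) ∧
    -- the base change map is a vector bundle over its image
    IsVectorBundle k (openRichardson K d I J)
      (baseChange I J hI hJ '' openRichardson K d I J) (baseChange I J hI hJ)
      (Finset.univ.filter fun p : Fin d × Fin n =>
        p.2 ∉ I ∪ J ∧ I.orderEmbOfFin hI p.1 < p.2 ∧ p.2 < J.orderEmbOfFin hJ p.1).card := by
  refine ⟨fun X hX => ?_, isLocallyClosedGr_openRichardson I J hI hJ,
    isZariskiLocallyClosed_image_baseChange I J hI hJ, isVectorBundle_baseChange k I J hI hJ⟩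
  have h := (rowSpace_mem_openRichardson_iff I J hI hJ X).1 hX
  exact ⟨h.1.1.isUnit, h.2.1.isUnit, baseChange_rowSpace hX hI hJ⟩
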